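/- Let $\mathcal U$ be any nonseparable complex Hilbert space and let $\ell^2_+(\mathcal U)$ be the Hilbert space of square summable sequences $(x_0,x_1,x_2,\dots)$ in $\mathcal U$; it is nonseparable. There exist orthonormal sequences in $\mathcal U$. Let $u_1,u_2,\dots$ be any orthonormal sequence in $\mathcal U$, let $\widetilde{\mathcal U}$ be the closure of its span, and let $T_0$ be the bounded operator on $\mathcal U$ that is the identity on $\widetilde{\mathcal U}^\perp$ and satisfies $T_0u_n=\frac1n u_n$ for $n=1,2,\dots$. Let $T$ be the bounded operator on $\ell^2_+(\mathcal U)$ given by $$T(x_0,x_1,x_2,\dots)=(0,T_0x_0,T_0x_1,T_0x_2,\dots).$$ For a bounded operator $S$ on a complex Hilbert space and $\varepsilon>0$ put $$\mathcal K_\varepsilon(S)=\ker\bigl(((S^*S)^{1/2}-\varepsilon I)\vee 0\bigr),\qquad \widetilde{\mathcal K}_\varepsilon(S)=\ker\bigl(((SS^*)^{1/2}-\varepsilon I)\vee 0\bigr),$$ where $A\vee 0$ denotes the positive part of the self-adjoint operator $A$ (functional calculus), and define the cardinal numbers $$\operatorname{ess\,null}S=\inf_{\varepsilon>0}\dim\mathcal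 K_\varepsilon(S),\qquad \operatorname{ess\,def}S=\inf_{\varepsilon>0}\dim\widetilde{\mathcal K}_\varepsilon(S),$$ where $\dim$ is the Hilbert space dimension (the cardinality of an orthonormal basis). Then: 1. For every $\varepsilon>0$, $\mathcal U\oplus\{0\}\oplus\{0\}\oplus\cdots\subset\widetilde{\mathcal K}_\varepsilon(T)$, and $\widetilde{\mathcal K}_\varepsilon(T)$ is nonseparable. 2. For every $\varepsilon>0$, $\mathcal K_\varepsilon(T)=\mathcal K_\varepsilon(T_0)\oplus\mathcal K_\varepsilon(T_0)\oplus\cdots$, that is, $x\in\mathcal K_\varepsilon(T)$ if and only if $x_n\in\mathcal K_\varepsilon(T_0)$ for all $n$; and $\mathcal K_\varepsilon(T)$ is separable for $0<\varepsilon<1$. 3. $\operatorname{ess\,null}T\neq\operatorname{ess\,def}T$. 4. $T$ is not a limit, in the operator norm, of (boundedly) invertible operators on $\ell^2_+(\mathcal U)$. 5. Neither $T_0$ nor $T$ has closed range. 6. $T$ is not generalized invertible: there is no bounded operator $T^+$ on $\ell^2_+(\mathcal U)$ with $T=TT^+T$ and $T^+=T^+TT^+$. -/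

import Mathlib

open scoped ENNReal

noncomputable section

namespace EssNull

universe u

section General

variable {H : Type u} [NormedAddCommGroup H] [InnerProductSpace ℂ H]

/-- The Hilbert dimension of a complex Hilbert space: the cardinality of an orthonormal basis
(all orthonormal bases have the same cardinality, so the infimum is over a one-element set). -/
def hilbertDim (E : Type u) [NormedAddCommGroup E] [InnerProductSpace ℂ E] : Cardinal.{u} :=
  sInf {c | ∃ s : Set E, Orthonormal ℂ (fun x : s => (x : E)) ∧
    (Submodule.span ℂ s).topologicalClosure = ⊤ ∧ Cardinal.mk s = c}

variable [CompleteSpace H]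

/-- `𝒦_ε(T) = ker ((X - ε I) ∨ 0)` with `X = (T* T)^{1/2}`; here `A ∨ 0 = A⁺` is the positive part
of the self-adjoint operator `A` in the sense of the continuous functional calculus. -/
def kerEps (T : H →L[ℂ] H) (ε : ℝ) : Submodule ℂ H :=
  LinearMap.ker
    (((CFC.sqrt (ContinuousLinearMap.adjoint T * T) - (ε : ℂ) • (1 : H →L[ℂ] H))⁺ :
      H →L[ℂ] H) : H →ₗ[ℂ] H)

/-- `𝒦̃_ε(T) = ker ((X̃ - ε I) ∨ 0)` with `X̃ = (T T*)^{1/2}`. -/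
def cokerEps (T : H →L[ℂ] H) (ε : ℝ) : Submodule ℂ H :=
  LinearMap.ker
    (((CFC.sqrt (T * ContinuousLinearMap.adjoint T) - (ε : ℂ) • (1 : H →L[ℂ] H))⁺ :
      H →L[ℂ] H) : H →ₗ[ℂ] H)

/-- The essential nullity of `T`. -/
def essNull (T : H →L[ℂ] H) : Cardinal.{u} :=
  sInf {c | ∃ ε : ℝ, 0 < ε ∧ hilbertDim (kerEps T ε) = c}

/-- The essential deficiency of `T`. -/
def essDef (T : H →L[ℂ] H) : Cardinal.{u} :=
  sInf {c | ∃ ε : ℝ, 0 < ε ∧ hilbertDim (cokerEps T ε) = c}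


/-- `T` can be approximated in norm by (boundedly) invertible operators. -/
def IsNormLimitOfInvertibles (T : H →L[ℂ] H) : Prop :=
  T ∈ closure {S : H →L[ℂ] H | IsUnit S}

/-- `T` has a bounded generalized inverse. -/
def IsGeneralizedInvertible (T : H →L[ℂ] H) : Prop :=
  ∃ R : H →L[ℂ] H, T = T * R * T ∧ R = R * T * R

end General

section Construction

/-- The Hilbert space `ℓ²₊(G)` of square summable sequences in `G`, indexed by `ℕ`. -/
abbrev EllTwo (G : Type u) [NormedAddCommGroup G] : Type u := lp (fun _ : ℕ => G) 2

variable {G : Type u} [NormedAddCommGroup G] [InnerProductSpace ℂ G]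

theorem blockDiag_le (A : ℕ → G →L[ℂ] G) (C : ℝ) (hA : ∀ n, ‖A n‖ ≤ C) (x : EllTwo G) (n : ℕ) :
    ‖A n (x n)‖ ^ (2 : ℝ≥0∞).toReal ≤
      C ^ (2 : ℝ≥0∞).toReal * ‖x n‖ ^ (2 : ℝ≥0∞).toReal := by
  have hC : 0 ≤ C := (norm_nonneg _).trans (hA 0)
  rw [← Real.mul_rpow hC (norm_nonneg _)]
  exact Real.rpow_le_rpow (norm_nonneg _) ((A n).le_of_opNorm_le (hA n) _) (by norm_num)

theorem blockDiag_summable (A : ℕ → G →L[ℂ] G) (C : ℝ) (hA : ∀ n, ‖A n‖ ≤ C) (x : EllTwo G) :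
    Summable fun n => ‖A n (x n)‖ ^ (2 : ℝ≥0∞).toReal :=
  Summable.of_nonneg_of_le (fun _ => by positivity) (blockDiag_le A C hA x)
    ((lp.hasSum_norm (p := 2) (by norm_num) x).summable.mul_left _)

/-- The block diagonal operator `diag (A 0, A 1, …)` on `ℓ²₊(G)`, for a uniformly bounded sequence
of operators `A n` on `G`. -/
def blockDiag (A : ℕ → G →L[ℂ] G) (C : ℝ) (hA : ∀ n, ‖A n‖ ≤ C) : EllTwo G →L[ℂ] EllTwo G :=
  LinearMap.mkContinuous
    { toFun := fun x => ⟨fun n => A n (x n), memℓp_gen (blockDiag_summable A C hA x)⟩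
      map_add' := fun x y => by ext n; exact map_add (A n) (x n) (y n)
      map_smul' := fun c x => by ext n; exact map_smul (A n) c (x n) }
    C (fun x => by
      have hC : 0 ≤ C := (norm_nonneg _).trans (hA 0)
      refine lp.norm_le_of_tsum_le (by norm_num) (by positivity) ?_
      rw [Real.mul_rpow hC (norm_nonneg _)]
      have hs := (lp.hasSum_norm (p := 2) (by norm_num) x).mul_left (C ^ (2 : ℝ≥0∞).toReal)
      rw [← hs.tsum_eq]
      exact (blockDiag_summable A C hA x).tsum_le_tsum (blockDiag_le A C hA x) hs.summable)

@[simp] theorem blockDiag_apply (A : ℕ → G →L[ℂ] G) (C : ℝ) (hA : ∀ n, ‖A n‖ ≤ C)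
    (x : EllTwo G) (n : ℕ) : blockDiag A C hA x n = A n (x n) := rfl

/-- The sequence `(0, x 0, x 1, …)`. -/
def shiftSeq {E : Type u} [NormedAddCommGroup E] (x : ℕ → E) : ℕ → E
  | 0 => 0
  | n + 1 => x n

theorem hasSum_shiftSeq {E : Type u} [NormedAddCommGroup E] (x : EllTwo E) :
    HasSum (fun n => ‖shiftSeq x n‖ ^ (2 : ℝ≥0∞).toReal) (‖x‖ ^ (2 : ℝ≥0∞).toReal) := by
  rw [← hasSum_nat_add_iff' 1]
  simpa [shiftSeq] using lp.hasSum_norm (p := 2) (by norm_num) x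

/-- The forward shift `(x 0, x 1, …) ↦ (0, x 0, x 1, …)` on `ℓ²₊(G)`. -/
def forwardShift : EllTwo G →L[ℂ] EllTwo G :=
  LinearMap.mkContinuous
    { toFun := fun x => ⟨shiftSeq x, memℓp_gen (hasSum_shiftSeq x).summable⟩
      map_add' := fun x y => by
        ext n
        cases n with
        | zero => exact (add_zero (0 : G)).symm
        | succ n => rfl
      map_smul' := fun c x => by
        ext n
        cases n with
        | zero => exact (smul_zero c).symm
        | succ n => rfl }
    1 (fun x => by
      rw [one_mul]
      exact lp.norm_le_of_tsum_le (by norm_num) (norm_nonneg _) (hasSum_shiftSeq x).tsum_eq.le)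

theorem diagScalar_bound (n : ℕ) :
    ‖(1 / ((n : ℂ) + 1)) • (1 : ℂ →L[ℂ] ℂ)‖ ≤ 1 := by
  have h : ‖(n : ℂ) + 1‖ = (n : ℝ) + 1 := by
    have := Complex.norm_natCast (n + 1)
    push_cast at this
    exact this
  rw [norm_smul, norm_div, norm_one, norm_one, mul_one, h]
  exact div_le_one_of_le₀ (by linarith [n.cast_nonneg (α := ℝ)]) (by positivity)

/-- The diagonal operator with entries `1, 1/2, 1/3, …` on scalar `ℓ²`. -/
def diagScalar : EllTwo ℂ →L[ℂ] EllTwo ℂ :=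
  blockDiag (fun n => (1 / ((n : ℂ) + 1)) • (1 : ℂ →L[ℂ] ℂ)) 1 diagScalar_bound

variable [CompleteSpace G]

/-- The closed linear span of a sequence. -/
def closedSpan (v : ℕ → G) : Submodule ℂ G := (Submodule.span ℂ (Set.range v)).topologicalClosure

/-- The isometry `ℓ² → G` that sends the standard basis to the orthonormal sequence `v`; its range
is the closed span of `v`. -/
def seqIsometry (v : ℕ → G) (hv : Orthonormal ℂ v) : EllTwo ℂ →L[ℂ] G :=
  hv.orthogonalFamily.linearIsometry.toContinuousLinearMap

/-- The operator `T₀` on `G` that is the identity on the orthogonal complement of the closed span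
of the orthonormal sequence `v`, and maps `v n` to `v n / (n + 1)`. -/
def diagOp (v : ℕ → G) (hv : Orthonormal ℂ v) : G →L[ℂ] G :=
  (closedSpan v)ᗮ.starProjection +
    seqIsometry v hv ∘L diagScalar ∘L ContinuousLinearMap.adjoint (seqIsometry v hv)

theorem diagOp_apply_of_mem_orthogonal (v : ℕ → G) (hv : Orthonormal ℂ v) {x : G}
    (hx : x ∈ (closedSpan v)ᗮ) : diagOp v hv x = x := by
  have h1 : (closedSpan v)ᗮ.starProjection x = x :=
    Submodule.starProjection_eq_self_iff.2 hx
  have h2 : ContinuousLinearMap.adjoint (seqIsometry v hv) x = 0 := by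
    refine ext_inner_left ℂ fun y => ?_
    rw [ContinuousLinearMap.adjoint_inner_right, inner_zero_right]
    refine hx _ ?_
    have hs := hv.orthogonalFamily.hasSum_linearIsometry y
    refine (Submodule.isClosed_topologicalClosure _).mem_of_tendsto hs
      (Filter.Eventually.of_forall fun s => ?_)
    refine Submodule.sum_mem _ fun i _ => Submodule.le_topologicalClosure _ ?_
    rw [LinearIsometry.toSpanSingleton_apply]
    exact Submodule.smul_mem _ _ (Submodule.subset_span ⟨i, rfl⟩)
  simp [diagOp, h1, h2]

theorem diagOp_apply_seq (v : ℕ → G) (hv : Orthonormal ℂ v) (n : ℕ) :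
    diagOp v hv (v n) = (1 / ((n : ℂ) + 1)) • v n := by
  have hmem : v n ∈ closedSpan v :=
    Submodule.le_topologicalClosure _ (Submodule.subset_span ⟨n, rfl⟩)
  have h1 : (closedSpan v)ᗮ.starProjection (v n) = 0 := by
    rw [Submodule.starProjection_apply_eq_zero_iff]
    exact Submodule.le_orthogonal_orthogonal _ hmem
  have h0 : ∀ c : ℂ, seqIsometry v hv (lp.single 2 n c) = c • v n := fun c => by
    simp [seqIsometry]
  have h2 : ContinuousLinearMap.adjoint (seqIsometry v hv) (v n) = lp.single 2 n 1 := by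
    refine ext_inner_left ℂ fun y => ?_
    rw [ContinuousLinearMap.adjoint_inner_right]
    have := h0 1
    rw [one_smul] at this
    rw [← this]
    exact hv.orthogonalFamily.linearIsometry.inner_map_map _ _
  have h3 : diagScalar (lp.single 2 n 1) = lp.single 2 n (1 / ((n : ℂ) + 1)) := by
    ext m
    by_cases h : m = n
    · subst h; simp [diagScalar]
    · simp [diagScalar, lp.single_apply, h]
  simp only [diagOp, add_apply, h1, zero_add, ContinuousLinearMap.comp_apply,
    h2, h3, h0]

/-- The weighted shift `T` on `ℓ²₊(G)`: the operator matrix with `T₀ = diagOp v hv` everywhere on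
the first subdiagonal and `0` elsewhere. -/
def shiftOp (v : ℕ → G) (hv : Orthonormal ℂ v) : EllTwo G →L[ℂ] EllTwo G :=
  forwardShift ∘L blockDiag (fun _ => diagOp v hv) ‖diagOp v hv‖ (fun _ => le_rfl)

@[simp] theorem shiftOp_apply_zero (v : ℕ → G) (hv : Orthonormal ℂ v) (x : EllTwo G) :
    shiftOp v hv x 0 = 0 := rfl

@[simp] theorem shiftOp_apply_succ (v : ℕ → G) (hv : Orthonormal ℂ v) (x : EllTwo G) (n : ℕ) :
    shiftOp v hv x (n + 1) = diagOp v hv (x n) := rfl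

end Construction

end EssNull

end

/-! `T` is the isometric shift composed with `diag (T₀, T₀, …)`, and its two sides differ in size.
Since the shift is isometric, `T* T = diag (T₀* T₀, …)`; functional calculus commutes with the
`*`-homomorphism `A ↦ diag (A, A, …)`, so `𝒦_ε(T)` is a sum of copies of `𝒦_ε(T₀)`
(`mem_kerEps_iff_of_map`). As `T₀` fixes `(closedSpan v)ᗮ`, for `ε < 1` each copy lies in the
separable space `closedSpan v` (`kerEps_diagOp_le`). On the other side `T*` kills every `(u, 0, 0,
…)`, and `ker T*` lies in every `𝒦̃_ε(T)` (`ker_adjoint_le_cokerEps`), which is therefore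
nonseparable. So `essNull T ≤ ℵ₀ < essDef T`.

Non-approximability is proved directly: for invertible `S`, a counting argument by separability
gives `m ≠ 0` with `‖T m‖ = ‖m‖` and `S m ⟂ T m`, so `‖S - T‖ ≥ 1` (`one_le_norm_sub_of_isUnit`).

`T₀` and `T` are injective but not bounded below, so their ranges are not closed, whereas a
generalized inverse would force closed range. -/

namespace EssNull

open ContinuousLinearMap TopologicalSpace
open scoped InnerProductSpace

universe u

/-! ### Separability, closed ranges, and eigenvectors of square roots and positive parts. -/

section Hilbert

variable {H : Type u} [NormedAddCommGroup H] [InnerProductSpace ℂ H]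

/-- Orthonormal families in a separable inner product space are countable. -/
theorem countable_of_orthonormal [SeparableSpace H] {ι : Type*} {w : ι → H}
    (hw : Orthonormal ℂ w) : Countable ι := by
  have hd : ∀ i j, i ≠ j → 1 < dist (w i) (w j) := by
    intro i j hij
    have h := norm_sub_sq (𝕜 := ℂ) (w i) (w j)
    rw [hw.2 hij, hw.1 i, hw.1 j] at h
    rw [dist_eq_norm]
    norm_num at h
    nlinarith [norm_nonneg (w i - w j)]
  have hdisj : (Set.univ : Set ι).PairwiseDisjoint fun i => Metric.ball (w i) (1 / 2) := by
    intro i _ j _ hij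
    exact Metric.ball_disjoint_ball (by linarith [hd i j hij])
  exact Set.countable_univ_iff.1 <| hdisj.countable_of_isOpen (fun _ _ => Metric.isOpen_ball)
    fun i _ => ⟨w i, Metric.mem_ball_self (by norm_num)⟩

theorem separableSpace_of_span_closure_eq_top {s : Set H} (hs : s.Countable)
    (h : (Submodule.span ℂ s).topologicalClosure = ⊤) : SeparableSpace H := by
  rw [← isSeparable_univ_iff]
  have h1 := (hs.isSeparable.span (R := ℂ)).closure
  rwa [← Submodule.topologicalClosure_coe, h, Submodule.top_coe] at h1

variable [CompleteSpace H]

theorem exists_orthonormal_dense_span : ∃ s : Set H, Orthonormal ℂ (fun x : s => (x : H)) ∧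
    (Submodule.span ℂ s).topologicalClosure = ⊤ := by
  obtain ⟨w, b, hb⟩ := exists_hilbertBasis ℂ H
  refine ⟨w, ?_, ?_⟩
  · have := b.orthonormal
    rwa [hb] at this
  · have := b.dense_span
    rwa [hb, Subtype.range_coe] at this

/-- The only fact about dimension that is needed. Cardinals are well ordered, so the infimum is
attained by some basis; equality of the cardinalities of all bases plays no role. -/
theorem hilbertDim_le_aleph0_iff : hilbertDim H ≤ Cardinal.aleph0 ↔ SeparableSpace H := by
  obtain ⟨s, hs, hsd⟩ := exists_orthonormal_dense_span (H := H)
  have hne : {c | ∃ s : Set H, Orthonormal ℂ (fun x : s => (x : H)) ∧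
    (Submodule.span ℂ s).topologicalClosure = ⊤ ∧ Cardinal.mk s = c}.Nonempty :=
    ⟨_, s, hs, hsd, rfl⟩
  constructor
  · intro h
    obtain ⟨t, -, htd, hc⟩ := csInf_mem hne
    refine separableSpace_of_span_closure_eq_top (s := t) ?_ htd
    rw [← Cardinal.le_aleph0_iff_set_countable, hc]
    exact h
  · intro h
    have h1 : hilbertDim H ≤ Cardinal.mk s := csInf_le' ⟨s, hs, hsd, rfl⟩
    exact h1.trans (Cardinal.mk_le_aleph0_iff.2 (countable_of_orthonormal hs))

theorem exists_orthonormal_seq_of_not_separable (h : ¬ SeparableSpace H) :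
    ∃ v : ℕ → H, Orthonormal ℂ v := by
  obtain ⟨s, hs, hsd⟩ := exists_orthonormal_dense_span (H := H)
  have : Infinite s := by
    rw [← not_finite_iff_infinite]
    intro hf
    exact h (separableSpace_of_span_closure_eq_top (Set.to_countable s) hsd)
  exact ⟨fun n => (Infinite.natEmbedding s n : H),
    hs.comp (Infinite.natEmbedding s) (Infinite.natEmbedding s).injective⟩

/-- A Hilbert space that embeds linearly and injectively into a Hilbert space with separable image
is separable. -/
theorem separableSpace_of_injective {K : Type*} [NormedAddCommGroup K] [InnerProductSpace ℂ K]
    [CompleteSpace K] (A : H →L[ℂ] K) (hA : Function.Injective A)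
    (hs : IsSeparable (Set.range A)) : SeparableSpace H := by
  have hker : (adjoint A ∘L A).ker = ⊥ := by
    rw [ker_adjoint_comp_self]
    exact LinearMap.ker_eq_bot.2 hA
  have hsa : adjoint (adjoint A ∘L A) = adjoint A ∘L A := by
    rw [adjoint_comp, adjoint_adjoint]
  -- `A* A` is self-adjoint and injective, so its range, the image under `A*` of a separable set, is
  -- dense.
  have htop : (adjoint A ∘L A).range.topologicalClosure = ⊤ := by
    rw [Submodule.topologicalClosure_eq_top_iff, orthogonal_range, hsa, hker]
  rw [← isSeparable_univ_iff, ← Submodule.top_coe (R := ℂ), ← htop,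
    Submodule.topologicalClosure_coe]
  refine IsSeparable.closure ?_
  have : ((adjoint A ∘L A).range : Set H) = adjoint A '' Set.range A := by
    ext y; simp
  rw [this]
  exact hs.image (adjoint A).continuous

/-- An injective operator that is not bounded below does not have closed range. -/
theorem not_isClosed_range_of_tendsto_zero (A : H →L[ℂ] H) (hA : Function.Injective A)
    (x : ℕ → H) (hx : ∀ n, ‖x n‖ = 1)
    (hlim : Filter.Tendsto (fun n => A (x n)) Filter.atTop (nhds 0)) :
    ¬ IsClosed (Set.range A) := by
  intro hc
  -- By the open mapping theorem, closed range and injectivity give a lower bound, which the unit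
  -- vectors `x n` violate.
  obtain ⟨K, hK⟩ := A.antilipschitz_of_injective_of_isClosed_range hA hc
  have h1 : ∀ n, 1 ≤ K * ‖A (x n)‖ := fun n => by
    simpa [hx] using hK.le_mul_dist (x n) 0
  have h2 := hlim.norm.const_mul (K : ℝ)
  rw [norm_zero, mul_zero] at h2
  exact absurd (ge_of_tendsto' h2 h1) (by norm_num)

-- From `A = A R A`, the range is the fixed-point set of the continuous map `A R`.
omit [CompleteSpace H] in
theorem isClosed_range_of_isGeneralizedInvertible {A : H →L[ℂ] H}
    (h : IsGeneralizedInvertible A) : IsClosed (Set.range A) := by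
  obtain ⟨R, hR, -⟩ := h
  have : Set.range A = {y | A (R y) = y} := by
    ext y
    constructor
    · rintro ⟨x, rfl⟩
      exact (DFunLike.congr_fun hR x).symm
    · intro hy
      exact ⟨R y, hy⟩
  rw [this]
  exact isClosed_eq (A.continuous.comp R.continuous) continuous_id

/-- The positive part of a self-adjoint operator annihilates eigenvectors for eigenvalues `≤ 0`. -/
theorem posPart_apply_eq_zero {A : H →L[ℂ] H} (hA : IsSelfAdjoint A) {z : H} {c : ℝ} (hc : c ≤ 0)
    (hz : A z = (c : ℂ) • z) : A⁺ z = 0 := by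
  have hP : (0 : H →L[ℂ] H) ≤ A⁺ := CFC.posPart_nonneg A
  have hpos := (nonneg_iff_isPositive _).1 hP
  -- From `A = A⁺ - A⁻` and `A⁺ A⁻ = 0`. Consequently `‖A⁺ z‖² = c ⟪z, A⁺ z⟫`, which is at most `0`
  -- because `c ≤ 0` and `A⁺` is positive.
  have hmul : A⁺ * A⁺ = A⁺ * A := by
    have h := congrArg (A⁺ * ·) (CFC.posPart_sub_negPart A hA)
    simpa only [mul_sub, CFC.posPart_mul_negPart, sub_zero] using h
  have h1 : A⁺ (A⁺ z) = (c : ℂ) • A⁺ z := by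
    have h : A⁺ (A⁺ z) = A⁺ (A z) := DFunLike.congr_fun hmul z
    rw [h, hz, map_smul]
  have h2 : ⟪A⁺ z, A⁺ z⟫_ℂ = c * ⟪z, A⁺ z⟫_ℂ := by
    rw [← inner_smul_right, ← h1]
    exact hpos.isSymmetric z (A⁺ z)
  have h3 : 0 ≤ (⟪z, A⁺ z⟫_ℂ).re := hpos.re_inner_nonneg_right z
  have h4 : ‖A⁺ z‖ ^ 2 = c * (⟪z, A⁺ z⟫_ℂ).re := by
    have := congrArg Complex.re h2
    rw [Complex.re_ofReal_mul] at this
    rw [← this]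
    exact (inner_self_eq_norm_sq (𝕜 := ℂ) _).symm
  have h5 : ‖A⁺ z‖ ^ 2 ≤ 0 := h4 ▸ mul_nonpos_of_nonpos_of_nonneg hc h3
  exact norm_eq_zero.1 (pow_eq_zero_iff two_ne_zero |>.1 (le_antisymm h5 (sq_nonneg _)))

/-- The previous lemma applied to `-A`, whose positive part is `A⁻`, gives `A⁻ z = 0`. -/
theorem posPart_apply_eq_self {A : H →L[ℂ] H} (hA : IsSelfAdjoint A) {z : H} {c : ℝ} (hc : 0 ≤ c)
    (hz : A z = (c : ℂ) • z) : A⁺ z = (c : ℂ) • z := by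
  have h : (-A)⁺ z = 0 :=
    posPart_apply_eq_zero hA.neg (neg_nonpos.2 hc) (by simp [hz])
  rw [CFC.posPart_neg] at h
  have h2 := DFunLike.congr_fun (CFC.posPart_sub_negPart A hA) z
  rw [sub_apply, h, sub_zero] at h2
  rw [h2, hz]

/-- The defect `y = √A z - z` satisfies `√A y = -y`, and positivity of `√A` rules out a nonzero
eigenvector for `-1`. -/
theorem sqrt_apply_eq_self {A : H →L[ℂ] H} (hA : 0 ≤ A) {z : H} (hz : A z = z) :
    CFC.sqrt A z = z := by
  have hpos := (nonneg_iff_isPositive _).1 (CFC.sqrt_nonneg A)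
  have hss : CFC.sqrt A (CFC.sqrt A z) = z := by
    exact (DFunLike.congr_fun (CFC.sqrt_mul_sqrt_self A hA) z).trans hz
  set y := CFC.sqrt A z - z with hy
  have h1 : CFC.sqrt A y = -y := by rw [hy, map_sub, hss]; abel
  have h2 := hpos.re_inner_nonneg_left y
  rw [h1, inner_neg_left, map_neg, inner_self_eq_norm_sq] at h2
  have h3 : y = 0 :=
    norm_eq_zero.1 (pow_eq_zero_iff two_ne_zero |>.1 (le_antisymm (by linarith) (sq_nonneg _)))
  exact sub_eq_zero.1 h3

theorem sqrt_apply_eq_zero {A : H →L[ℂ] H} (hA : 0 ≤ A) {z : H} (hz : A z = 0) :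
    CFC.sqrt A z = 0 := by
  have hpos := (nonneg_iff_isPositive _).1 (CFC.sqrt_nonneg A)
  have hss : CFC.sqrt A (CFC.sqrt A z) = 0 := by
    exact (DFunLike.congr_fun (CFC.sqrt_mul_sqrt_self A hA) z).trans hz
  have : ⟪CFC.sqrt A z, CFC.sqrt A z⟫_ℂ = 0 := by
    have := hpos.isSymmetric z (CFC.sqrt A z)
    simp only [coe_coe] at this
    rw [this, hss, inner_zero_right]
  exact inner_self_eq_zero.1 this

theorem isSelfAdjoint_sqrt_sub_smul (A : H →L[ℂ] H) (ε : ℝ) :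
    IsSelfAdjoint (CFC.sqrt A - (ε : ℂ) • (1 : H →L[ℂ] H)) := by
  refine (IsSelfAdjoint.of_nonneg (CFC.sqrt_nonneg A)).sub ?_
  refine IsSelfAdjoint.smul ?_ (IsSelfAdjoint.one _)
  exact Complex.conj_ofReal ε

/-- On `ker A*` the operator `√(A A*) - ε` acts as the negative scalar `-ε`, which the positive part
annihilates. -/
theorem ker_adjoint_le_cokerEps (A : H →L[ℂ] H) {ε : ℝ} (hε : 0 < ε) {z : H}
    (hz : adjoint A z = 0) : z ∈ cokerEps A ε := by
  refine posPart_apply_eq_zero (isSelfAdjoint_sqrt_sub_smul _ ε) (c := -ε) (by linarith) ?_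
  have h1 : CFC.sqrt (A * adjoint A) z = 0 :=
    sqrt_apply_eq_zero (mul_star_self_nonneg A) (by
      change A (adjoint A z) = 0
      rw [hz, map_zero])
  simp [h1]

/-- Vectors fixed by `A* A` are orthogonal to `𝒦_ε(A)` for `ε < 1`. -/
theorem inner_eq_zero_of_mem_kerEps {A : H →L[ℂ] H} {ε : ℝ} (hε : ε < 1) {q z : H}
    (hq : adjoint A (A q) = q) (hz : z ∈ kerEps A ε) : ⟪q, z⟫_ℂ = 0 := by
  set P := (CFC.sqrt (adjoint A * A) - (ε : ℂ) • (1 : H →L[ℂ] H))⁺ with hPdef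
  have hP0 : (0 : H →L[ℂ] H) ≤ P := CFC.posPart_nonneg _
  have hz' : P z = 0 := hz
  have h1 : CFC.sqrt (adjoint A * A) q = q :=
    sqrt_apply_eq_self (star_mul_self_nonneg A) hq
  -- Thus `q` and `z` are eigenvectors of the self-adjoint `P` for the distinct eigenvalues `1 - ε >
  -- 0` and `0`.
  have h2 : P q = ((1 - ε : ℝ) : ℂ) • q :=
    posPart_apply_eq_self (isSelfAdjoint_sqrt_sub_smul _ ε) (by linarith) (by
      simp [h1, sub_smul])
  have h3 := ((nonneg_iff_isPositive _).1 hP0).isSymmetric q z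
  simp only [coe_coe] at h3
  rw [hz', inner_zero_right, h2, inner_smul_left] at h3
  refine (mul_eq_zero.1 h3).resolve_left ?_
  rw [Complex.conj_ofReal, Complex.ofReal_eq_zero]
  linarith

end Hilbert

/-! ### Square roots and positive parts under `*`-homomorphisms. -/

section Map

variable {H K : Type*} [NormedAddCommGroup H] [InnerProductSpace ℂ H] [CompleteSpace H]
  [NormedAddCommGroup K] [InnerProductSpace ℂ K] [CompleteSpace K]
  (φ : (H →L[ℂ] H) →⋆ₐ[ℂ] (K →L[ℂ] K))

/-- A `*`-homomorphism preserves positivity, so uniqueness of the positive square root suffices;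
likewise, below, uniqueness of the decomposition into positive and negative parts. -/
theorem sqrt_map {A : H →L[ℂ] H} (hA : 0 ≤ A) : CFC.sqrt (φ A) = φ (CFC.sqrt A) := by
  refine CFC.sqrt_unique ?_ (map_nonneg φ (CFC.sqrt_nonneg A))
  rw [← map_mul, CFC.sqrt_mul_sqrt_self A hA]

theorem posPart_map {A : H →L[ℂ] H} (hA : IsSelfAdjoint A) : (φ A)⁺ = φ A⁺ := by
  refine (CFC.posPart_negPart_unique (b := φ A⁺) (c := φ A⁻) (a := φ A) ?_ ?_
    (map_nonneg φ (CFC.posPart_nonneg A)) (map_nonneg φ (CFC.negPart_nonneg A))).1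
  · rw [← map_sub, CFC.posPart_sub_negPart A hA]
  · rw [← map_mul, CFC.posPart_mul_negPart, map_zero]

theorem mem_kerEps_iff_of_map {S : K →L[ℂ] K} {A : H →L[ℂ] H}
    (h : adjoint S * S = φ (adjoint A * A)) (ε : ℝ) (x : K) :
    x ∈ kerEps S ε ↔
      φ (CFC.sqrt (adjoint A * A) - (ε : ℂ) • (1 : H →L[ℂ] H))⁺ x = 0 := by
  have h0 : (CFC.sqrt (adjoint S * S) - (ε : ℂ) • (1 : K →L[ℂ] K))⁺ =
      φ (CFC.sqrt (adjoint A * A) - (ε : ℂ) • (1 : H →L[ℂ] H))⁺ := by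
    rw [h, sqrt_map φ (A := adjoint A * A) (star_mul_self_nonneg A),
      ← posPart_map φ (isSelfAdjoint_sqrt_sub_smul _ ε), map_sub, map_smul, map_one]
  rw [← h0]
  rfl

end Map

/-! ### Block diagonal operators and the forward shift on `ℓ²₊(G)`. -/

section BlockDiag

variable {G : Type u} [NormedAddCommGroup G] [InnerProductSpace ℂ G] [CompleteSpace G]

omit [CompleteSpace G] in
theorem inner_single_left (n : ℕ) (y : G) (x : EllTwo G) :
    ⟪(lp.single (E := fun _ : ℕ => G) 2 n y : EllTwo G), x⟫_ℂ = ⟪y, x n⟫_ℂ :=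
  lp.inner_single_left (𝕜 := ℂ) (G := fun _ : ℕ => G) n y x

omit [InnerProductSpace ℂ G] [CompleteSpace G] in
theorem continuous_single (n : ℕ) :
    Continuous fun y : G => (lp.single (E := fun _ : ℕ => G) 2 n y : EllTwo G) :=
  (lp.isometry_single (E := fun _ : ℕ => G) (p := 2) n).continuous

theorem adjoint_blockDiag_apply (A : ℕ → G →L[ℂ] G) (C : ℝ) (hA : ∀ n, ‖A n‖ ≤ C)
    (x : EllTwo G) (n : ℕ) : adjoint (blockDiag A C hA) x n = adjoint (A n) (x n) := by
  refine ext_inner_left ℂ fun (y : G) => ?_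
  have h : blockDiag A C hA (lp.single 2 n y) = lp.single 2 n (A n y) := by
    ext m
    rcases eq_or_ne m n with rfl | hm
    · simp
    · simp [lp.single_apply, hm]
  rw [adjoint_inner_right, ← inner_single_left, adjoint_inner_right]
  exact (inner_single_left n (A n y) x).symm.trans (congrArg (⟪·, x⟫_ℂ) h.symm) |>.symm

/-- The operator `diag (A, A, …)`. -/
noncomputable def constBlockDiag (A : G →L[ℂ] G) : EllTwo G →L[ℂ] EllTwo G :=
  blockDiag (fun _ => A) ‖A‖ fun _ => le_rfl

omit [CompleteSpace G] in
theorem constBlockDiag_apply (A : G →L[ℂ] G) (x : EllTwo G) (n : ℕ) :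
    constBlockDiag A x n = A (x n) := rfl

omit [CompleteSpace G] in
theorem constBlockDiag_eq {A : G →L[ℂ] G} {S : EllTwo G →L[ℂ] EllTwo G}
    (h : ∀ x n, A (x n) = S x n) : constBlockDiag A = S :=
  ContinuousLinearMap.ext fun x => lp.ext <| funext fun n => h x n

theorem adjoint_constBlockDiag (A : G →L[ℂ] G) :
    adjoint (constBlockDiag A) = constBlockDiag (adjoint A) :=
  ContinuousLinearMap.ext fun x => lp.ext <| funext fun n =>
    adjoint_blockDiag_apply (fun _ => A) ‖A‖ (fun _ => le_rfl) x n

theorem constBlockDiag_star (A : G →L[ℂ] G) :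
    constBlockDiag (star A) = star (constBlockDiag A) := by
  rw [star_eq_adjoint, star_eq_adjoint, adjoint_constBlockDiag]

omit [CompleteSpace G] in
theorem constBlockDiag_smul (c : ℂ) (A : G →L[ℂ] G) :
    constBlockDiag (c • A) = c • constBlockDiag A :=
  constBlockDiag_eq fun _ _ => rfl

omit [CompleteSpace G] in
theorem constBlockDiag_one : constBlockDiag (1 : G →L[ℂ] G) = 1 :=
  constBlockDiag_eq fun _ _ => rfl

/-- The `*`-homomorphism that maps `A` to `diag (A, A, …)`. -/
noncomputable def constDiag : (G →L[ℂ] G) →⋆ₐ[ℂ] (EllTwo G →L[ℂ] EllTwo G) where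
  toFun := constBlockDiag
  map_one' := constBlockDiag_one
  map_mul' _ _ := constBlockDiag_eq fun _ _ => rfl
  map_zero' := constBlockDiag_eq fun _ _ => rfl
  map_add' _ _ := constBlockDiag_eq fun _ _ => rfl
  commutes' c := by
    rw [Algebra.algebraMap_eq_smul_one, Algebra.algebraMap_eq_smul_one, constBlockDiag_smul,
      constBlockDiag_one]
  map_star' := constBlockDiag_star

/-- If `S* S = diag (A* A, A* A, …)`, then `𝒦_ε(S)` is the direct sum of copies of `𝒦_ε(A)`. -/
theorem mem_kerEps_iff_of_adjoint_mul_self {S : EllTwo G →L[ℂ] EllTwo G} {A : G →L[ℂ] G}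
    (h : adjoint S * S = constBlockDiag (adjoint A * A)) (ε : ℝ) (x : EllTwo G) :
    x ∈ kerEps S ε ↔ ∀ n, x n ∈ kerEps A ε := by
  rw [mem_kerEps_iff_of_map constDiag h, lp.ext_iff, funext_iff]
  rfl

omit [CompleteSpace G] in
/-- Square summable sequences in a separable set form a separable set. -/
theorem isSeparable_setOf_forall_mem {s : Set G} (hs : IsSeparable s) :
    IsSeparable {x : EllTwo G | ∀ n, x n ∈ s} := by
  have h1 : IsSeparable
      (⋃ n : ℕ, (fun y : G => (lp.single (E := fun _ : ℕ => G) 2 n y : EllTwo G)) '' s) :=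
    IsSeparable.iUnion fun n => hs.image (continuous_single n)
  -- Each `x` is the norm limit of its finite truncations, which lie in the span of the separable
  -- set of singles with entries in `s`.
  refine (h1.span (R := ℂ)).closure.mono fun x hx => ?_
  refine mem_closure_of_tendsto (lp.hasSum_single (by norm_num) x)
    (Filter.Eventually.of_forall fun t => ?_)
  exact Submodule.sum_mem _ fun i _ =>
    Submodule.subset_span (Set.mem_iUnion.2 ⟨i, Set.mem_image_of_mem _ (hx i)⟩)

omit [CompleteSpace G] in
theorem norm_forwardShift (x : EllTwo G) : ‖forwardShift x‖ = ‖x‖ := by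
  have h := (lp.hasSum_norm (p := 2) (by norm_num) (forwardShift x)).unique (hasSum_shiftSeq x)
  exact (Real.rpow_left_inj (norm_nonneg _) (norm_nonneg _) (by norm_num)).1 h

theorem adjoint_forwardShift_single_zero (u : G) :
    adjoint (forwardShift (G := G)) (lp.single 2 0 u) = 0 := by
  refine ext_inner_right ℂ fun y => ?_
  rw [adjoint_inner_left, lp.inner_single_left, inner_zero_left]
  exact inner_zero_right _

theorem adjoint_comp_forwardShift :
    adjoint (forwardShift (G := G)) ∘L forwardShift = 1 :=
  (norm_map_iff_adjoint_comp_self _).1 norm_forwardShift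

end BlockDiag

/-! ### The operators `T₀` and `T`. -/

section Shift

variable {G : Type u} [NormedAddCommGroup G] [InnerProductSpace ℂ G]

theorem adjoint_diagScalar : adjoint diagScalar = diagScalar := by
  refine ContinuousLinearMap.ext fun x => lp.ext <| funext fun n => ?_
  refine (adjoint_blockDiag_apply _ 1 diagScalar_bound x n).trans ?_
  refine DFunLike.congr_fun (?_ : _ = (1 / ((n : ℂ) + 1)) • (1 : ℂ →L[ℂ] ℂ)) (x n)
  rw [← star_eq_adjoint, star_smul, star_one]
  simp

theorem isSeparable_closedSpan (v : ℕ → G) : IsSeparable (closedSpan v : Set G) := by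
  rw [closedSpan, Submodule.topologicalClosure_coe]
  exact ((Set.countable_range v).isSeparable.span (R := ℂ)).closure

variable [CompleteSpace G]

theorem orthogonal_orthogonal_closedSpan (v : ℕ → G) : (closedSpan v)ᗮᗮ = closedSpan v := by
  rw [Submodule.orthogonal_orthogonal_eq_closure]
  exact (Submodule.isClosed_topologicalClosure _).submodule_topologicalClosure_eq

theorem adjoint_shift_mul_self (A : G →L[ℂ] G) :
    adjoint (forwardShift ∘L constBlockDiag A) * (forwardShift ∘L constBlockDiag A) =
      constBlockDiag (adjoint A * A) := by
  change adjoint (forwardShift ∘L constBlockDiag A) ∘L (forwardShift ∘L constBlockDiag A) = _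
  rw [adjoint_comp, comp_assoc, ← comp_assoc _ forwardShift, adjoint_comp_forwardShift,
    adjoint_constBlockDiag]
  exact (constBlockDiag_eq fun _ _ => rfl).symm

variable (v : ℕ → G) (hv : Orthonormal ℂ v)

theorem adjoint_diagOp : adjoint (diagOp v hv) = diagOp v hv := by
  rw [diagOp, map_add, adjoint_comp, adjoint_comp, adjoint_adjoint, adjoint_diagScalar,
    comp_assoc]
  congr 1
  exact (isSelfAdjoint_starProjection _).star_eq

/-- By self-adjointness, a kernel vector is orthogonal to every eigenvector `v n`, whose eigenvalue
is nonzero; so it lies in `(closedSpan v)ᗮ`, where `T₀` is the identity. -/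
theorem diagOp_injective : Function.Injective (diagOp v hv) := by
  rw [injective_iff_map_eq_zero]
  intro z hz
  have h1 : ∀ n, ⟪v n, z⟫_ℂ = 0 := fun n => by
    have h : ⟪diagOp v hv (v n), z⟫_ℂ = 0 := by
      rw [← adjoint_inner_right, adjoint_diagOp, hz, inner_zero_right]
    rw [diagOp_apply_seq, inner_smul_left] at h
    refine (mul_eq_zero.1 h).resolve_left ?_
    rw [map_eq_zero]
    exact one_div_ne_zero (Nat.cast_add_one_ne_zero n)
  have h2 : z ∈ (closedSpan v)ᗮ := by
    rw [closedSpan, Submodule.orthogonal_closure, Submodule.mem_orthogonal]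
    intro y hy
    induction hy using Submodule.span_induction with
    | mem y hy => obtain ⟨n, rfl⟩ := hy; exact h1 n
    | zero => exact inner_zero_left _
    | add a b _ _ ha hb => rw [inner_add_left, ha, hb, add_zero]
    | smul c a _ ha => rw [inner_smul_left, ha, mul_zero]
  rw [← diagOp_apply_of_mem_orthogonal v hv h2, hz]

theorem shiftOp_eq : shiftOp v hv = forwardShift ∘L constBlockDiag (diagOp v hv) := rfl

theorem norm_shiftOp (x : EllTwo G) :
    ‖shiftOp v hv x‖ = ‖constBlockDiag (diagOp v hv) x‖ :=
  norm_forwardShift _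

theorem shiftOp_injective : Function.Injective (shiftOp v hv) := by
  intro x y h
  refine lp.ext <| funext fun n => diagOp_injective v hv ?_
  rw [← shiftOp_apply_succ, ← shiftOp_apply_succ, h]

theorem norm_diagOp_seq (n : ℕ) : ‖diagOp v hv (v n)‖ = 1 / ((n : ℝ) + 1) := by
  have h : ‖(n : ℂ) + 1‖ = (n : ℝ) + 1 := by
    have := Complex.norm_natCast (n + 1)
    push_cast at this
    exact this
  rw [diagOp_apply_seq, norm_smul, hv.1, norm_div, norm_one, h, mul_one]

theorem not_isClosed_range_diagOp : ¬ IsClosed (Set.range (diagOp v hv)) := by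
  refine not_isClosed_range_of_tendsto_zero _ (diagOp_injective v hv) v hv.1 ?_
  rw [tendsto_zero_iff_norm_tendsto_zero]
  simp only [norm_diagOp_seq]
  exact tendsto_one_div_add_atTop_nhds_zero_nat

omit [CompleteSpace G] in
theorem constBlockDiag_single (A : G →L[ℂ] G) (n : ℕ) (y : G) :
    constBlockDiag A (lp.single (E := fun _ : ℕ => G) 2 n y) =
      lp.single (E := fun _ : ℕ => G) 2 n (A y) := by
  refine lp.ext <| funext fun m => ?_
  rcases eq_or_ne m n with rfl | hm
  · simp [constBlockDiag_apply]
  · simp [constBlockDiag_apply, lp.single_apply, hm]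

omit [InnerProductSpace ℂ G] [CompleteSpace G] in
theorem norm_single (n : ℕ) (y : G) :
    ‖(lp.single (E := fun _ : ℕ => G) 2 n y : EllTwo G)‖ = ‖y‖ :=
  lp.norm_single (E := fun _ : ℕ => G) (by norm_num) n y

theorem not_isClosed_range_shiftOp : ¬ IsClosed (Set.range (shiftOp v hv)) := by
  refine not_isClosed_range_of_tendsto_zero _ (shiftOp_injective v hv)
    (fun n => lp.single (E := fun _ : ℕ => G) 2 0 (v n))
    (fun n => (norm_single 0 (v n)).trans (hv.1 n)) ?_
  rw [tendsto_zero_iff_norm_tendsto_zero]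
  simp only [norm_shiftOp, constBlockDiag_single, norm_single, norm_diagOp_seq]
  exact tendsto_one_div_add_atTop_nhds_zero_nat

theorem adjoint_shiftOp_single_zero (u : G) :
    adjoint (shiftOp v hv) (lp.single (E := fun _ : ℕ => G) 2 0 u) = 0 := by
  rw [shiftOp_eq, adjoint_comp, comp_apply, adjoint_forwardShift_single_zero, map_zero]

theorem single_zero_mem_cokerEps {ε : ℝ} (hε : 0 < ε) (u : G) :
    lp.single (E := fun _ : ℕ => G) 2 0 u ∈ cokerEps (shiftOp v hv) ε :=
  ker_adjoint_le_cokerEps _ hε (adjoint_shiftOp_single_zero v hv u)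

theorem mem_kerEps_shiftOp_iff (ε : ℝ) (x : EllTwo G) :
    x ∈ kerEps (shiftOp v hv) ε ↔ ∀ n, x n ∈ kerEps (diagOp v hv) ε :=
  mem_kerEps_iff_of_adjoint_mul_self (adjoint_shift_mul_self _) ε x

theorem kerEps_diagOp_le {ε : ℝ} (hε : ε < 1) : kerEps (diagOp v hv) ε ≤ closedSpan v := by
  intro z hz
  rw [← orthogonal_orthogonal_closedSpan, Submodule.mem_orthogonal]
  intro q hq
  refine inner_eq_zero_of_mem_kerEps hε ?_ hz
  rw [adjoint_diagOp, diagOp_apply_of_mem_orthogonal v hv hq,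
    diagOp_apply_of_mem_orthogonal v hv hq]

theorem isSeparable_kerEps_shiftOp {ε : ℝ} (hε : ε < 1) :
    IsSeparable (kerEps (shiftOp v hv) ε : Set (EllTwo G)) :=
  (isSeparable_setOf_forall_mem (isSeparable_closedSpan v)).mono fun x hx n =>
    kerEps_diagOp_le v hv hε ((mem_kerEps_shiftOp_iff v hv ε x).1 hx n)

omit [CompleteSpace G] in
/-- A set that contains all sequences `(u, 0, 0, …)` is nonseparable if `G` is. -/
theorem not_isSeparable_of_single_mem (hG : ¬ SeparableSpace G) {s : Set (EllTwo G)}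
    (hs : ∀ u : G, lp.single (E := fun _ : ℕ => G) 2 0 u ∈ s) : ¬ IsSeparable s := by
  intro h
  refine hG ?_
  rw [← isSeparable_univ_iff]
  refine (h.image (lp.evalCLM ℂ (fun _ : ℕ => G) (p := 2) 0).continuous).mono fun u _ => ?_
  exact ⟨_, hs u, lp.single_apply_self (E := fun _ : ℕ => G) 2 0 u⟩

theorem essNull_shiftOp_le : essNull (shiftOp v hv) ≤ Cardinal.aleph0 := by
  -- Any `ε` in `(0, 1)` would serve.
  have h1 : essNull (shiftOp v hv) ≤ hilbertDim (kerEps (shiftOp v hv) (1 / 2)) :=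
    csInf_le' ⟨1 / 2, by norm_num, rfl⟩
  have : CompleteSpace (kerEps (shiftOp v hv) (1 / 2)) :=
    (ContinuousLinearMap.isClosed_ker _).completeSpace_coe
  have : SeparableSpace (kerEps (shiftOp v hv) (1 / 2)) :=
    (isSeparable_kerEps_shiftOp v hv (by norm_num)).separableSpace
  exact h1.trans (hilbertDim_le_aleph0_iff.2 this)

theorem aleph0_lt_essDef_shiftOp (hG : ¬ SeparableSpace G) :
    Cardinal.aleph0 < essDef (shiftOp v hv) := by
  have hne : {c | ∃ ε : ℝ, 0 < ε ∧ hilbertDim (cokerEps (shiftOp v hv) ε) = c}.Nonempty :=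
    ⟨_, 1, one_pos, rfl⟩
  -- The infimum is attained, so the strict inequality need only be checked at one `ε`.
  obtain ⟨ε, hε, h⟩ := csInf_mem hne
  have : CompleteSpace (cokerEps (shiftOp v hv) ε) :=
    (ContinuousLinearMap.isClosed_ker _).completeSpace_coe
  refine lt_of_not_ge fun hle => ?_
  have hsep := hilbertDim_le_aleph0_iff.1 (h.le.trans hle)
  refine not_isSeparable_of_single_mem hG (single_zero_mem_cokerEps v hv hε) ?_
  exact IsSeparable.of_subtype (cokerEps (shiftOp v hv) ε : Set (EllTwo G))

/-- If `G` is nonseparable, then `T` has distance at least `1` from the invertible operators. -/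
theorem one_le_norm_sub_of_isUnit (hG : ¬ SeparableSpace G) {S : EllTwo G →L[ℂ] EllTwo G}
    (hS : IsUnit S) : 1 ≤ ‖S - shiftOp v hv‖ := by
  obtain ⟨⟨S, R, hSR, -⟩, rfl⟩ := hS
  set P : G →L[ℂ] G := (closedSpan v)ᗮ.starProjection with hP
  -- `Q` projects each coordinate onto `closedSpan v`, so `Q R J` has separable range. As `G` is
  -- nonseparable, `Q R J` kills some `u ≠ 0`; then all coordinates of `m = R (J u)` lie in
  -- `(closedSpan v)ᗮ`, where `T₀` is the identity.
  let Q : EllTwo G →L[ℂ] EllTwo G := constBlockDiag (1 - P)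
  let J : G →L[ℂ] EllTwo G := lp.singleContinuousLinearMap ℂ (fun _ : ℕ => G) 2 0
  have hQ : IsSeparable (Set.range (Q ∘L R ∘L J)) := by
    refine (isSeparable_setOf_forall_mem (isSeparable_closedSpan v)).mono ?_
    rintro _ ⟨u, rfl⟩ n
    change (R (J u)) n - P ((R (J u)) n) ∈ closedSpan v
    rw [← orthogonal_orthogonal_closedSpan]
    exact Submodule.sub_starProjection_mem_orthogonal _
  have hinj : ¬ Function.Injective (Q ∘L R ∘L J) := fun h =>
    hG (separableSpace_of_injective _ h hQ)
  rw [injective_iff_map_eq_zero] at hinj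
  push Not at hinj
  obtain ⟨u, hu, hu0⟩ := hinj
  set m := R (J u) with hm
  have hSm : S m = J u := DFunLike.congr_fun hSR (J u)
  have hTm : ‖shiftOp v hv m‖ = ‖m‖ := by
    rw [norm_shiftOp]
    congr 1
    refine lp.ext <| funext fun n => ?_
    have h1 : m n - P (m n) = 0 := congrFun (congrArg Subtype.val hu) n
    refine diagOp_apply_of_mem_orthogonal v hv ?_
    rw [sub_eq_zero.1 h1]
    exact Submodule.starProjection_apply_mem _ _
  have hm0 : 0 < ‖m‖ := by
    rw [norm_pos_iff]
    intro h
    rw [h, map_zero] at hSm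
    have h2 := norm_single 0 u
    rw [norm_eq_zero.2 (show (lp.single (E := fun _ : ℕ => G) 2 0 u : EllTwo G) = 0 from
      hSm.symm)] at h2
    exact hu0 (norm_eq_zero.1 h2.symm)
  -- `S m = J u = (u, 0, 0, …)` lies in `ker T*`, which is orthogonal to the range of `T`.
  have horth : ⟪shiftOp v hv m, S m⟫_ℂ = 0 := by
    rw [← adjoint_inner_right, hSm]
    exact (congrArg _ (adjoint_shiftOp_single_zero v hv u)).trans (inner_zero_right _)
  have hpyth : ‖m‖ ^ 2 ≤ ‖(S - shiftOp v hv) m‖ ^ 2 := by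
    rw [sub_apply, norm_sub_rev, norm_sub_sq (𝕜 := ℂ), horth, hTm, map_zero, mul_zero, sub_zero]
    exact le_add_of_nonneg_right (sq_nonneg _)
  have h1 := (pow_le_pow_iff_left₀ (norm_nonneg _) (norm_nonneg _) two_ne_zero).1 hpyth
  have h2 := h1.trans (le_opNorm _ m)
  exact le_of_mul_le_mul_right (by rwa [one_mul]) hm0

theorem not_isNormLimitOfInvertibles_shiftOp (hG : ¬ SeparableSpace G) :
    ¬ IsNormLimitOfInvertibles (shiftOp v hv) := by
  intro h
  obtain ⟨S, hS, hd⟩ := Metric.mem_closure_iff.1 h 1 one_pos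
  rw [dist_eq_norm, norm_sub_rev] at hd
  exact absurd (one_le_norm_sub_of_isUnit v hv hG hS) (not_le.2 hd)

end Shift

end EssNull

theorem mainTheorem6 {U : Type*} [NormedAddCommGroup U] [InnerProductSpace ℂ U] [CompleteSpace U]
    (hU : ¬ TopologicalSpace.SeparableSpace U) :
    ¬ TopologicalSpace.SeparableSpace (EssNull.EllTwo U) ∧
    (∃ v : ℕ → U, Orthonormal ℂ v) ∧
    ∀ (v : ℕ → U) (hv : Orthonormal ℂ v),
      (∀ ε : ℝ, 0 < ε →
        (∀ x : U, lp.single 2 0 x ∈ EssNull.cokerEps (EssNull.shiftOp v hv) ε) ∧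
        ¬ TopologicalSpace.IsSeparable
          (EssNull.cokerEps (EssNull.shiftOp v hv) ε : Set (EssNull.EllTwo U))) ∧
      (∀ ε : ℝ, 0 < ε → ∀ x : EssNull.EllTwo U,
        x ∈ EssNull.kerEps (EssNull.shiftOp v hv) ε ↔
          ∀ n : ℕ, x n ∈ EssNull.kerEps (EssNull.diagOp v hv) ε) ∧
      (∀ ε : ℝ, 0 < ε → ε < 1 →
        TopologicalSpace.IsSeparable
          (EssNull.kerEps (EssNull.shiftOp v hv) ε : Set (EssNull.EllTwo U))) ∧
      EssNull.essNull (EssNull.shiftOp v hv) ≠ EssNull.essDef (EssNull.shiftOp v hv) ∧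
      ¬ EssNull.IsNormLimitOfInvertibles (EssNull.shiftOp v hv) ∧
      ¬ IsClosed (Set.range (EssNull.diagOp v hv)) ∧
      ¬ IsClosed (Set.range (EssNull.shiftOp v hv)) ∧
      ¬ EssNull.IsGeneralizedInvertible (EssNull.shiftOp v hv) := by

  refine ⟨fun h => ?_, EssNull.exists_orthonormal_seq_of_not_separable hU, fun v hv =>
    ⟨fun ε hε => ?_, fun ε _ => EssNull.mem_kerEps_shiftOp_iff v hv ε,
      fun ε _ h => EssNull.isSeparable_kerEps_shiftOp v hv h,
      ((EssNull.essNull_shiftOp_le v hv).trans_lt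
        (EssNull.aleph0_lt_essDef_shiftOp v hv hU)).ne,
      EssNull.not_isNormLimitOfInvertibles_shiftOp v hv hU,
      EssNull.not_isClosed_range_diagOp v hv, EssNull.not_isClosed_range_shiftOp v hv,
      fun h => EssNull.not_isClosed_range_shiftOp v hv
        (EssNull.isClosed_range_of_isGeneralizedInvertible h)⟩⟩
  · exact EssNull.not_isSeparable_of_single_mem hU (fun _ => Set.mem_univ _)
      (TopologicalSpace.isSeparable_univ_iff.2 h)
  · exact ⟨EssNull.single_zero_mem_cokerEps v hv hε,
      EssNull.not_isSeparable_of_single_mem hU (EssNull.single_zero_mem_cokerEps v hv hε)⟩
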